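/- **Conventions.** A plot of a diffeological space $X$ is a smooth map $P:U\to X$ from an open set $U\subseteq\mathbb{R}^k$, for any $k\ge 0$; a subset of $X$ is D-open if its preimage under every plot is open. Products and subsets carry the product and subspace diffeologies. For a smooth map $f:X\to Y$ and a plot $P:U\to Y$, put $P^*X=\{(r,x)\in U\times X: P(r)=f(x)\}$ and $P^*f:P^*X\to U$, $(r,x)\mapsto r$. - A smooth map $g:X\to Y$ is a *submersion* if for each $x_0\in X$ there are a D-open $O\subseteq Y$ and a smooth $\sigma:O\to X$ with $g(\sigma(y))=y$ for all $y\in O$ and $x_0\in\sigma(O)$. It is *étale* if for each $x_0\in X$ there are D-open neighbourhoods $O$ of $x_0$ and $O'$ of $g(x_0)$ such that $g$ restricts to a diffeomorphism $O\to O'$. - A smooth map $f:X\to Y$ is a *diffeological submersion* (respectively a *diffeological étale map*) if $P^*f$ is a submersion (respectively étale) for every plot $P$ of $Y$. It is a *diffeological immersion* if for every plot $P:U\to Y$ and every $(r_0,x_0)\in P^*X$ there are a D-open neighbourhood $O$ of $(r_0,x_0)$ in $P^*X$, an open set $V\subseteq U$ containing $P^*f(O)$, and a smooth map $\varrho:V\to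 U\times X$ with $\varrho(r)=(r,x)$ for all $(r,x)\in O$. - A *diffeological étale $n$-manifold* is a diffeological space that is covered by the images of a family of diffeological étale maps defined on open subsets of $\mathbb{R}^n$. - The *internal tangent space* $T_xX$ is the colimit, in real vector spaces, of the spaces $T_0\,\mathrm{dom}(P)$ over the plots $P$ of $X$ with $0\in\mathrm{dom}(P)$ and $P(0)=x$. The morphisms $Q\to P$ are the germs at $0$ of smooth maps $F$ with $F(0)=0$ and $Q=P\circ F$ near $0$; they act by $dF_0$. Write $dP_0:T_0\,\mathrm{dom}(P)\to T_xX$ for the colimit maps. For a smooth map $f:X\to Y$, the *internal tangent map* $df_x:T_xX\to T_{f(x)}Y$ is the unique linear map with $df_x\circ dP_0=d(f\circ P)_0$ for all such $P$. **Theorem.** Let $\mathcal M$ and $\mathcal N$ be diffeological étale manifolds of dimensions $m$ and $n$, respectively, and let $f:\mathcal M\to\mathcal N$ be a smooth map. 1. If $df_x:T_x\mathcal M\to T_{f(x)}\mathcal N$ is surjective at each point $x\in\mathcal M$, then $f$ is a diffeological submersion. 2. If $df_x:T_x\mathcal M\to T_{f(x)}\mathcal N$ is injective at each point $x\in\mathcal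 M$, then $f$ is a diffeological immersion. 3. If $df_x:T_x\mathcal M\to T_{f(x)}\mathcal N$ is an isomorphism at each point $x\in\mathcal M$, then $f$ is a diffeological étale map. -/

import Mathlib

open TopologicalSpace Diffeology
open scoped ContDiff DirectSum Topology

universe u v w

namespace DiffeologicalEtale

/-! ### Subspaces, products, pullbacks

Diffeological spaces and smooth maps are those of Mathlib: a diffeology is given by its plots
`EuclideanSpace ℝ (Fin n) → X`, and `DSmooth` is smoothness. A plot defined on an `n`-domain,
i.e. on an open set `U` of `EuclideanSpace ℝ (Fin n)`, is a smooth map `U → X`, where `U` has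
the subspace diffeology. -/

/-- The subspace diffeology: the plots of the ambient space with values in the subspace. -/
instance instSubspace {X : Type u} [DiffeologicalSpace X] (p : X → Prop) :
    DiffeologicalSpace (Subtype p) where
  plots _ := {q | IsPlot fun r => (q r : X)}
  constant_plots _ := isPlot_const
  plot_reparam hp hf := isPlot_reparam (X := X) hp hf
  locality {n q} h := DiffeologicalSpace.locality (X := X) (p := fun r => (q r : X)) fun r => by
    obtain ⟨s, hs, hr, H⟩ := h r
    exact ⟨s, hs, hr, fun hfs hf => H hfs hf⟩

/-- The product diffeology: pairs of plots. -/
instance instProduct {X : Type u} {Y : Type v} [DiffeologicalSpace X] [DiffeologicalSpace Y] :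
    DiffeologicalSpace (X × Y) where
  plots _ := {q | IsPlot (fun r => (q r).1) ∧ IsPlot (fun r => (q r).2)}
  constant_plots _ := ⟨isPlot_const, isPlot_const⟩
  plot_reparam hp hf := ⟨isPlot_reparam hp.1 hf, isPlot_reparam hp.2 hf⟩
  locality {n q} h :=
    ⟨DiffeologicalSpace.locality (X := X) (p := fun r => (q r).1) fun r => by
      obtain ⟨s, hs, hr, H⟩ := h r
      exact ⟨s, hs, hr, fun hfs hf => (H hfs hf).1⟩,
    DiffeologicalSpace.locality (X := Y) (p := fun r => (q r).2) fun r => by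
      obtain ⟨s, hs, hr, H⟩ := h r
      exact ⟨s, hs, hr, fun hfs hf => (H hfs hf).2⟩⟩

/-- D-open subsets: open for the D-topology. -/
def IsDOpen {X : Type u} [DiffeologicalSpace X] (O : Set X) : Prop :=
  IsOpen[Diffeology.dTopology] O

/-- The space `g^*X = {(z, x) | g z = f x}`, a subspace of `Z × X`. -/
abbrev Pullback {X : Type u} {Y : Type v} {Z : Type w} (f : X → Y) (g : Z → Y) : Type (max u w) :=
  {p : Z × X // g p.1 = f p.2}

/-- The pullback `g^*f : g^*X → Z`, `(z, x) ↦ z`. -/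
def pullbackMap {X : Type u} {Y : Type v} {Z : Type w} (f : X → Y) (g : Z → Y) :
    Pullback f g → Z :=
  fun p => p.1.1

/-! ### Submersions, immersions, étale maps -/

/-- A submersion: through every point of `X` passes a smooth local section of `f` defined on a
D-open subset of `Y`. -/
def IsSubmersion {X : Type u} {Y : Type v} [DiffeologicalSpace X] [DiffeologicalSpace Y]
    (f : X → Y) : Prop :=
  DSmooth f ∧ ∀ x₀ : X, ∃ O : Set Y, IsDOpen O ∧ ∃ σ : O → X,
    DSmooth σ ∧ (∀ y : O, f (σ y) = y) ∧ x₀ ∈ Set.range σ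

/-- A diffeological submersion: the pullback by every plot in `Y` is a submersion. -/
def IsDiffeologicalSubmersion {X : Type u} {Y : Type v} [DiffeologicalSpace X]
    [DiffeologicalSpace Y] (f : X → Y) : Prop :=
  DSmooth f ∧ ∀ (n : ℕ) (U : Opens (EuclideanSpace ℝ (Fin n))) (P : U → Y), DSmooth P →
    IsSubmersion (pullbackMap f P)

/-- A diffeological immersion: for every plot `P : U → Y` and every point of `P^*X` there are a
D-open neighbourhood `O` of it in `P^*X`, an open set `V ⊆ U` containing `P^*f (O)`, and a smooth
map `ϱ : V → U × X` with `ϱ (P^*f (r, x)) = (r, x)` for all `(r, x) ∈ O`. -/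
def IsDiffeologicalImmersion {X : Type u} {Y : Type v} [DiffeologicalSpace X]
    [DiffeologicalSpace Y] (f : X → Y) : Prop :=
  DSmooth f ∧ ∀ (n : ℕ) (U : Opens (EuclideanSpace ℝ (Fin n))) (P : U → Y), DSmooth P →
    ∀ p₀ : Pullback f P, ∃ O : Set (Pullback f P), IsDOpen O ∧ p₀ ∈ O ∧
      ∃ (V : Set U) (hV : Set.MapsTo (pullbackMap f P) O V), IsOpen V ∧
        ∃ ϱ : V → U × X, DSmooth ϱ ∧
          ∀ (p : Pullback f P) (hp : p ∈ O), ϱ ⟨pullbackMap f P p, hV hp⟩ = p.1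

/-- A diffeomorphism: a smooth map with a smooth inverse. -/
def IsDiffeomorphism {X : Type u} {Y : Type v} [DiffeologicalSpace X] [DiffeologicalSpace Y]
    (f : X → Y) : Prop :=
  DSmooth f ∧ ∃ g : Y → X, DSmooth g ∧ Function.LeftInverse g f ∧ Function.RightInverse g f

/-- An étale map: it restricts to a diffeomorphism from some D-open neighbourhood of any given
point onto a D-open neighbourhood of the image point. -/
def IsEtale {X : Type u} {Y : Type v} [DiffeologicalSpace X] [DiffeologicalSpace Y]
    (f : X → Y) : Prop :=
  ∀ x₀ : X, ∃ (O : Set X) (O' : Set Y) (h : Set.MapsTo f O O'),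
    IsDOpen O ∧ IsDOpen O' ∧ x₀ ∈ O ∧ f x₀ ∈ O' ∧ IsDiffeomorphism (h.restrict f O O')

/-- A diffeological étale map: the pullback by every plot in `Y` is étale. -/
def IsDiffeologicalEtale {X : Type u} {Y : Type v} [DiffeologicalSpace X]
    [DiffeologicalSpace Y] (f : X → Y) : Prop :=
  DSmooth f ∧ ∀ (n : ℕ) (U : Opens (EuclideanSpace ℝ (Fin n))) (P : U → Y), DSmooth P →
    IsEtale (pullbackMap f P)

/-- A diffeological étale `n`-manifold: it is covered by the images of a family of diffeological
étale maps defined on `n`-domains. -/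
def IsEtaleManifold (n : ℕ) (M : Type u) [DiffeologicalSpace M] : Prop :=
  ∃ A : Set ((U : Opens (EuclideanSpace ℝ (Fin n))) × (U → M)),
    (∀ φ ∈ A, IsDiffeologicalEtale φ.2) ∧ ∀ x : M, ∃ φ ∈ A, x ∈ Set.range φ.2

/-! ### Internal tangent spaces -/

/-- A plot centered at `x`: a plot `P : U → X` with `0 ∈ U` and `P 0 = x`. -/
structure CenteredPlot (X : Type u) [DiffeologicalSpace X] (x : X) where
  /-- The dimension of the domain. -/
  dim : ℕ
  /-- The domain `U`. -/
  dom : Opens (EuclideanSpace ℝ (Fin dim))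
  zero_mem : 0 ∈ dom
  /-- The plot itself. -/
  toFun : dom → X
  smooth : DSmooth toFun
  map_zero : toFun ⟨0, zero_mem⟩ = x

/-- The plot `f ∘ P` centered at `f x`. -/
def CenteredPlot.map {X : Type u} {Y : Type v} [DiffeologicalSpace X] [DiffeologicalSpace Y]
    {f : X → Y} (hf : DSmooth f) {x : X} (P : CenteredPlot X x) : CenteredPlot Y (f x) where
  dim := P.dim
  dom := P.dom
  zero_mem := P.zero_mem
  toFun := fun r => f (P.toFun r)
  smooth := hf.comp P.smooth
  map_zero := congrArg f P.map_zero

/-- The map `F` represents a morphism `Q ⟶ P` of germs of plots centered at `x`: on some open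
neighbourhood `W ⊆ dom Q` of `0` it is smooth with values in `dom P`, it satisfies `F 0 = 0`, and
`Q = P ∘ F` on `W`. (Only the values of `F` on `W` matter.) -/
def IsPlotMorphism {X : Type u} [DiffeologicalSpace X] {x : X} (Q P : CenteredPlot X x)
    (F : EuclideanSpace ℝ (Fin Q.dim) → EuclideanSpace ℝ (Fin P.dim)) : Prop :=
  F 0 = 0 ∧ ∃ W : Opens (EuclideanSpace ℝ (Fin Q.dim)), 0 ∈ W ∧ ContDiffOn ℝ ∞ F W ∧
    ∀ r ∈ W, ∃ (hQ : r ∈ Q.dom) (hP : F r ∈ P.dom), Q.toFun ⟨r, hQ⟩ = P.toFun ⟨F r, hP⟩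

/-- The direct sum of the tangent spaces `T₀(dom P)` over all plots `P` centered at `x`. -/
abbrev PlotSum (X : Type u) [DiffeologicalSpace X] (x : X) : Type u :=
  ⨁ P : CenteredPlot X x, EuclideanSpace ℝ (Fin P.dim)

open Classical in
/-- The inclusion of the summand `T₀(dom P)`. -/
noncomputable def plotIncl {X : Type u} [DiffeologicalSpace X] {x : X} (P : CenteredPlot X x) :
    EuclideanSpace ℝ (Fin P.dim) →ₗ[ℝ] PlotSum X x :=
  DirectSum.lof ℝ (CenteredPlot X x) (fun P => EuclideanSpace ℝ (Fin P.dim)) P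

/-- The relations identifying `v ∈ T₀(dom Q)` with `dF₀ v ∈ T₀(dom P)` for every morphism
`F : Q ⟶ P` of germs of centered plots. -/
def plotRel (X : Type u) [DiffeologicalSpace X] (x : X) : Submodule ℝ (PlotSum X x) :=
  Submodule.span ℝ {z | ∃ (Q P : CenteredPlot X x)
    (F : EuclideanSpace ℝ (Fin Q.dim) → EuclideanSpace ℝ (Fin P.dim))
    (v : EuclideanSpace ℝ (Fin Q.dim)),
    IsPlotMorphism Q P F ∧ z = plotIncl Q v - plotIncl P (fderiv ℝ F 0 v)}

/-- The internal tangent space `T_x X`: the colimit of the vector spaces `T₀(dom P)` over the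
category of germs of plots `P` centered at `x`, as the direct sum modulo the relations of the
diagram. -/
abbrev InternalTangentSpace (X : Type u) [DiffeologicalSpace X] (x : X) : Type u :=
  PlotSum X x ⧸ plotRel X x

/-- The linear map `dP₀ : T₀(dom P) → T_x X` of the colimit cocone. -/
noncomputable def dPlot {X : Type u} [DiffeologicalSpace X] {x : X} (P : CenteredPlot X x) :
    EuclideanSpace ℝ (Fin P.dim) →ₗ[ℝ] InternalTangentSpace X x :=
  (plotRel X x).mkQ ∘ₗ plotIncl P

theorem dPlot_comp {X : Type u} [DiffeologicalSpace X] {x : X} {Q P : CenteredPlot X x}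
    {F : EuclideanSpace ℝ (Fin Q.dim) → EuclideanSpace ℝ (Fin P.dim)}
    (hF : IsPlotMorphism Q P F) (v : EuclideanSpace ℝ (Fin Q.dim)) :
    dPlot P (fderiv ℝ F 0 v) = dPlot Q v :=
  ((Submodule.Quotient.eq (plotRel X x)).2 (Submodule.subset_span
    (show plotIncl Q v - plotIncl P (fderiv ℝ F 0 v) ∈ _ from ⟨Q, P, F, v, hF, rfl⟩))).symm

theorem IsPlotMorphism.map {X : Type u} {Y : Type v} [DiffeologicalSpace X] [DiffeologicalSpace Y]
    {f : X → Y} (hf : DSmooth f) {x : X} {Q P : CenteredPlot X x}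
    {F : EuclideanSpace ℝ (Fin Q.dim) → EuclideanSpace ℝ (Fin P.dim)}
    (hF : IsPlotMorphism Q P F) : IsPlotMorphism (Q.map hf) (P.map hf) F := by
  obtain ⟨h0, W, hW, hc, h⟩ := hF
  refine ⟨h0, W, hW, hc, fun r hr => ?_⟩
  obtain ⟨hQ, hP, e⟩ := h r hr
  exact ⟨hQ, hP, congrArg f e⟩

open Classical in
/-- The cocone `d(f ∘ P)₀ : T₀(dom P) → T_{f x} Y`, as a map on the direct sum. -/
noncomputable def tangentMapAux {X : Type u} {Y : Type v} [DiffeologicalSpace X]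
    [DiffeologicalSpace Y] {f : X → Y} (hf : DSmooth f) (x : X) :
    PlotSum X x →ₗ[ℝ] InternalTangentSpace Y (f x) :=
  DirectSum.toModule ℝ (CenteredPlot X x) (InternalTangentSpace Y (f x))
    fun P => dPlot (P.map hf)

theorem tangentMapAux_plotIncl {X : Type u} {Y : Type v} [DiffeologicalSpace X]
    [DiffeologicalSpace Y] {f : X → Y} (hf : DSmooth f) {x : X} (P : CenteredPlot X x)
    (v : EuclideanSpace ℝ (Fin P.dim)) :
    tangentMapAux hf x (plotIncl P v) = dPlot (P.map hf) v := by
  classical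
  unfold tangentMapAux plotIncl
  exact DirectSum.toModule_lof (M := fun P : CenteredPlot X x => EuclideanSpace ℝ (Fin P.dim))
    ℝ P v

theorem plotRel_le_ker {X : Type u} {Y : Type v} [DiffeologicalSpace X]
    [DiffeologicalSpace Y] {f : X → Y} (hf : DSmooth f) (x : X) :
    plotRel X x ≤ LinearMap.ker (tangentMapAux hf x) := by
  refine Submodule.span_le.2 ?_
  rintro _ ⟨Q, P, F, v, hF, rfl⟩
  rw [SetLike.mem_coe, LinearMap.mem_ker, map_sub, tangentMapAux_plotIncl,
    tangentMapAux_plotIncl, sub_eq_zero]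
  exact (dPlot_comp (hF.map hf) v).symm

/-- The internal tangent map `df_x : T_x X → T_{f x} Y`, induced by the universal property of the
colimit. -/
noncomputable def tangentMap {X : Type u} {Y : Type v} [DiffeologicalSpace X]
    [DiffeologicalSpace Y] {f : X → Y} (hf : DSmooth f) (x : X) :
    InternalTangentSpace X x →ₗ[ℝ] InternalTangentSpace Y (f x) :=
  (plotRel X x).liftQ (tangentMapAux hf x) (plotRel_le_ker hf x)

/-- The characterizing property `df_x ∘ dP₀ = d(f ∘ P)₀`. -/
theorem tangentMap_dPlot {X : Type u} {Y : Type v} [DiffeologicalSpace X]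
    [DiffeologicalSpace Y] {f : X → Y} (hf : DSmooth f) {x : X} (P : CenteredPlot X x)
    (v : EuclideanSpace ℝ (Fin P.dim)) :
    tangentMap hf x (dPlot P v) = dPlot (P.map hf) v :=
  tangentMapAux_plotIncl hf P v

end DiffeologicalEtale

/-!
An étale chart `φ` has unique lifting of germs of plots, so the derivative of the lift turns
`T_{φ u} M` into the coordinate space `ℝᵐ`, and `df` into the derivative at `u` of the local
representative `F` of `f`, which lifts `f ∘ φ` through an étale chart `ψ` of `N`. The inverse
function theorem then provides a smooth local right or left inverse `s` of `F`. Given a plot `P` of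
`N` with a lift `L` through `ψ`, the map `r ↦ (r, φ (s (L r)))` is a local section of `P^*f` if `s`
is a right inverse, and retracts `P^*f` near the given point if `s` is a left inverse. Finally, a
diffeological submersion that is also a diffeological immersion is étale.
-/

namespace DiffeologicalEtale

local notation:max "ℝ^" k:max => EuclideanSpace ℝ (Fin k)

section Topology

theorem exists_contDiff_forall_mem_of_mem_nhds {E : Type*} [NormedAddCommGroup E]
    [InnerProductSpace ℝ E] {a : E} {S : Set E} (hS : S ∈ 𝓝 a) :
    ∃ e e' : E → E, ContDiff ℝ ∞ e ∧ (∀ x, e x ∈ S) ∧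
      ∀ᶠ x in 𝓝 a, ContDiffAt ℝ ∞ e' x ∧ e (e' x) = x := by
  obtain ⟨ε, hε, hεS⟩ := Metric.mem_nhds_iff.1 hS
  let Φ := OpenPartialHomeomorph.univBall a ε
  have hΦ : Φ.target = Metric.ball a ε := OpenPartialHomeomorph.univBall_target a hε
  refine ⟨Φ, Φ.symm, OpenPartialHomeomorph.contDiff_univBall, fun x => hεS ?_, ?_⟩
  · exact hΦ ▸ Φ.map_source (by simp [Φ])
  · filter_upwards [Metric.ball_mem_nhds a hε] with x hx
    exact ⟨OpenPartialHomeomorph.contDiffOn_univBall_symm.contDiffAt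
      (Metric.isOpen_ball.mem_nhds hx), Φ.right_inv (hΦ.symm ▸ hx)⟩

variable {X : Type u} {Y : Type v} [DiffeologicalSpace X] [DiffeologicalSpace Y]

theorem isDOpen_iff_eventually {O : Set X} :
    IsDOpen O ↔ ∀ (k : ℕ) (p : ℝ^k → X), IsPlot p → ∀ t₀, p t₀ ∈ O → ∀ᶠ t in 𝓝 t₀, p t ∈ O :=
  isOpen_iff_preimages_plots.trans <| forall₃_congr fun _ _ _ => isOpen_iff_mem_nhds

theorem IsDOpen.preimage {f : X → Y} (hf : DSmooth f) {O : Set Y} (hO : IsDOpen O) :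
    IsDOpen (f ⁻¹' O) :=
  isOpen_iff_preimages_plots.2 fun k p hp => isOpen_iff_preimages_plots.1 hO k _ (hf k p hp)

theorem IsDOpen.inter {O O' : Set X} (hO : IsDOpen O) (hO' : IsDOpen O') : IsDOpen (O ∩ O') :=
  isOpen_iff_preimages_plots.2 fun k p hp =>
    (isOpen_iff_preimages_plots.1 hO k p hp).inter (isOpen_iff_preimages_plots.1 hO' k p hp)

theorem dSmooth_subtypeVal {p : X → Prop} : DSmooth (Subtype.val : Subtype p → X) :=
  fun _ _ hq => hq

theorem IsDOpen.image_val {O : Set X} (hO : IsDOpen O) {S : Set O} (hS : IsDOpen S) :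
    IsDOpen (Subtype.val '' S : Set X) := by
  refine isDOpen_iff_eventually.2 fun k p hp t₀ => ?_
  rintro ⟨y, hy, hyt₀⟩
  have hpO : p ⁻¹' O ∈ 𝓝 t₀ :=
    isDOpen_iff_eventually.1 hO k p hp t₀ (hyt₀ ▸ y.2)
  -- Reparametrized by `e`, the plot `p` near `t₀` becomes a plot of the subspace `O`.
  obtain ⟨e, e', he, heO, hee'⟩ := exists_contDiff_forall_mem_of_mem_nhds hpO
  have hq : IsPlot fun t => (⟨p (e t), heO t⟩ : O) := isPlot_reparam hp he
  obtain ⟨he'₀, ht₀⟩ := hee'.self_of_nhds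
  have hqS : (⟨p (e (e' t₀)), heO _⟩ : O) ∈ S := by
    convert hy
    rw [ht₀, hyt₀]
  filter_upwards [he'₀.continuousAt.eventually (isDOpen_iff_eventually.1 hS k _ hq _ hqS), hee']
    with t htS ⟨_, ht⟩
  exact ⟨_, htS, congrArg p ht⟩

theorem isDOpen_iff_isOpen {k : ℕ} {W : Opens ℝ^k} {O : Set W} : IsDOpen O ↔ IsOpen O := by
  have hval {k : ℕ} {S : Set ℝ^k} : IsDOpen S ↔ IsOpen S := by
    rw [IsDOpen, IsDTopologyCompatible.dTop_eq]
  rw [W.isOpen.isOpenEmbedding_subtypeVal.isOpen_iff_image_isOpen]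
  refine ⟨fun hO => hval.1 (IsDOpen.image_val (hval.2 W.isOpen) hO), fun hO => ?_⟩
  have hO' : IsDOpen (Subtype.val ⁻¹' (Subtype.val '' O) : Set W) :=
    (hval.2 hO).preimage dSmooth_subtypeVal
  rwa [Set.preimage_image_eq O Subtype.val_injective] at hO'

theorem IsDOpen.image_val_mem_nhds {k : ℕ} {W : Opens ℝ^k} {O : Set W} (hO : IsDOpen O) {r : W}
    (hr : r ∈ O) : Subtype.val '' O ∈ 𝓝 (r : ℝ^k) :=
  (W.isOpen.isOpenMap_subtype_val _ (isDOpen_iff_isOpen.1 hO)).mem_nhds ⟨r, hr, rfl⟩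

theorem exists_contDiffAt_of_dSmooth {k m : ℕ} {W : Opens ℝ^k} {O : Set W} (hO : IsDOpen O)
    {g : O → ℝ^m} (hg : DSmooth g) :
    ∃ L : ℝ^k → ℝ^m, ∀ y : O, L y = g y ∧ ContDiffAt ℝ ∞ L y := by
  have hval : Function.Injective fun y : O => (y : ℝ^k) :=
    Subtype.val_injective.comp Subtype.val_injective
  let L : ℝ^k → ℝ^m := Function.extend (fun y : O => (y : ℝ^k)) g 0
  have hL (y : O) : L y = g y := hval.extend_apply g 0 y
  refine ⟨L, fun y => ⟨hL y, ?_⟩⟩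
  obtain ⟨e, e', he, heO, hee'⟩ :=
    exists_contDiff_forall_mem_of_mem_nhds (hO.image_val_mem_nhds y.2)
  choose z hzO hz using heO
  have hzp : IsPlot fun t => (z t : ℝ^k) := by simpa only [hz] using he.isPlot
  have hLe : (fun t => g ⟨z t, hzO t⟩) = L ∘ e :=
    funext fun t => (hL ⟨z t, hzO t⟩).symm.trans (congrArg L (hz t))
  have hLes : ContDiff ℝ ∞ (L ∘ e) :=
    hLe ▸ IsPlot.contDiff (hg k (fun t => ⟨z t, hzO t⟩) hzp)
  refine (hLes.contDiffAt.comp _ hee'.self_of_nhds.1).congr_of_eventuallyEq ?_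
  filter_upwards [hee'] with r hr
  exact congrArg L hr.2.symm

end Topology

section Etale

variable {X : Type u} {Y : Type v} [DiffeologicalSpace X] [DiffeologicalSpace Y] {f : X → Y}

theorem IsEtale.exists_isDOpen_injOn (hf : IsEtale f) (x : X) :
    ∃ O : Set X, IsDOpen O ∧ x ∈ O ∧ Set.InjOn f O := by
  obtain ⟨O, O', hOO', hO, -, hx, -, -, g, -, hgf, -⟩ := hf x
  exact ⟨O, hO, hx, hOO'.restrict_inj.1 hgf.injective⟩

theorem IsEtale.isSubmersion (hs : DSmooth f) (hf : IsEtale f) : IsSubmersion f := by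
  refine ⟨hs, fun x => ?_⟩
  obtain ⟨O, O', hOO', -, hO', hx, -, -, g, hg, hgf, hfg⟩ := hf x
  exact ⟨O', hO', fun y => g y, dSmooth_subtypeVal.comp hg, fun y => congrArg Subtype.val (hfg y),
    hOO'.restrict f O O' ⟨x, hx⟩, congrArg Subtype.val (hgf ⟨x, hx⟩)⟩

theorem IsSubmersion.isEtale (hf : IsSubmersion f)
    (hinj : ∀ x, ∃ O : Set X, IsDOpen O ∧ x ∈ O ∧ Set.InjOn f O) : IsEtale f := by
  intro x
  obtain ⟨O, hO, hxO, hfO⟩ := hinj x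
  obtain ⟨B, hB, σ, hσ, hfσ, y, rfl⟩ := hf.2 x
  -- On `O ∩ f ⁻¹' B'` the section `σ` is inverse to `f`, by injectivity of `f` on `O`.
  let B' : Set Y := Subtype.val '' (σ ⁻¹' O)
  have hB' : IsDOpen B' := hB.image_val (hO.preimage hσ)
  have hB'B : B' ⊆ B := Subtype.coe_image_subset B _
  have hσO {z : Y} (hz : z ∈ B') : σ ⟨z, hB'B hz⟩ ∈ O := by
    obtain ⟨b, hb, rfl⟩ := hz
    exact hb
  have hmaps : Set.MapsTo f (O ∩ f ⁻¹' B') B' := fun _ h => h.2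
  let g : B' → ↥(O ∩ f ⁻¹' B') := fun z =>
    ⟨σ ⟨z, hB'B z.2⟩, hσO z.2, by simpa only [Set.mem_preimage, hfσ] using z.2⟩
  have hyB' : f (σ y) ∈ B' := ⟨y, hxO, (hfσ y).symm⟩
  refine ⟨O ∩ f ⁻¹' B', B', hmaps, hO.inter (hB'.preimage hf.1), hB', ⟨hxO, hyB'⟩, hyB',
    fun _ _ hp => hf.1 _ _ hp, g, fun k p hp => hσ k (fun t => ⟨p t, hB'B (p t).2⟩) hp,
    fun x => ?_, fun z => Subtype.ext (hfσ _)⟩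
  exact Subtype.ext (hfO (hσO x.2.2) x.2.1 (hfσ _))

theorem IsDiffeologicalEtale.isDiffeologicalSubmersion (hf : IsDiffeologicalEtale f) :
    IsDiffeologicalSubmersion f :=
  ⟨hf.1, fun k W P hP => (hf.2 k W P hP).isSubmersion fun _ _ hp => hp.1⟩

theorem IsDiffeologicalSubmersion.isDiffeologicalEtale (hf : IsDiffeologicalSubmersion f)
    (hf' : IsDiffeologicalImmersion f) : IsDiffeologicalEtale f := by
  refine ⟨hf.1, fun k W P hP => (hf.2 k W P hP).isEtale fun p₀ => ?_⟩
  obtain ⟨O, hO, hp₀, V, hV, -, ϱ, -, hϱ⟩ := hf'.2 k W P hP p₀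
  refine ⟨O, hO, hp₀, fun p hp q hq hpq => Subtype.ext ?_⟩
  rw [← hϱ p hp, ← hϱ q hq]
  exact congrArg ϱ (Subtype.ext hpq)

end Etale

/-- The map `L` lifts the plot `P` through the plot `φ` on a neighbourhood of `r₀`; equivalently,
the germ of `L` at `r₀` is a morphism of germs of plots from `P` to `φ`. Smoothness is required at
each point near `r₀`, since `ContDiffAt ℝ ∞ L r₀` alone does not give smoothness on any
neighbourhood of `r₀`. -/
def IsLiftAt {E F : Type*} [NormedAddCommGroup E] [NormedSpace ℝ E] [NormedAddCommGroup F]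
    [NormedSpace ℝ F] {X : Type*} {U : Opens F} {W : Opens E} (φ : U → X) (P : W → X) (L : E → F)
    (r₀ : E) : Prop :=
  ∀ᶠ r in 𝓝 r₀, ContDiffAt ℝ ∞ L r ∧ ∃ (hr : r ∈ W) (hu : L r ∈ U), φ ⟨L r, hu⟩ = P ⟨r, hr⟩

namespace IsLiftAt

variable {E F G : Type*} [NormedAddCommGroup E] [NormedSpace ℝ E] [NormedAddCommGroup F]
  [NormedSpace ℝ F] [NormedAddCommGroup G] [NormedSpace ℝ G] {X Y : Type*} {U : Opens F}
  {V : Opens G} {W : Opens E} {φ : U → X} {ψ : V → X} {P : W → X} {L : E → F} {r₀ : E}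

theorem eventually_contDiffAt (hL : IsLiftAt φ P L r₀) : ∀ᶠ r in 𝓝 r₀, ContDiffAt ℝ ∞ L r :=
  hL.mono fun _ h => h.1

theorem eventually_isLiftAt (hL : IsLiftAt φ P L r₀) : ∀ᶠ r in 𝓝 r₀, IsLiftAt φ P L r :=
  eventually_eventually_nhds.2 hL

theorem contDiffAt (hL : IsLiftAt φ P L r₀) : ContDiffAt ℝ ∞ L r₀ :=
  hL.self_of_nhds.1

theorem differentiableAt (hL : IsLiftAt φ P L r₀) : DifferentiableAt ℝ L r₀ :=
  hL.contDiffAt.differentiableAt (by simp)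

theorem continuousAt (hL : IsLiftAt φ P L r₀) : ContinuousAt L r₀ :=
  hL.contDiffAt.continuousAt

theorem map (hL : IsLiftAt φ P L r₀) (f : X → Y) : IsLiftAt (f ∘ φ) (f ∘ P) L r₀ :=
  hL.mono fun _ ⟨hs, hr, hu, h⟩ => ⟨hs, hr, hu, congrArg f h⟩

theorem comp {M : F → G} (hM : IsLiftAt ψ φ M (L r₀)) (hL : IsLiftAt φ P L r₀) :
    IsLiftAt ψ P (M ∘ L) r₀ := by
  filter_upwards [hL, hL.continuousAt.eventually hM] with r ⟨hLr, hr, _, hφ⟩ ⟨hMr, _, hv, hψ⟩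
  exact ⟨hMr.comp r hLr, hr, hv, hψ.trans hφ⟩

theorem of_rightInverse (hL : IsLiftAt φ P L r₀) {s : F → E} (hs₀ : s (L r₀) = r₀)
    (hs : ∀ᶠ u in 𝓝 (L r₀), ContDiffAt ℝ ∞ s u ∧ L (s u) = u) : IsLiftAt P φ s (L r₀) := by
  have hsc : Filter.Tendsto s (𝓝 (L r₀)) (𝓝 r₀) := by
    simpa only [hs₀] using hs.self_of_nhds.1.continuousAt.tendsto
  filter_upwards [hs, hsc.eventually hL] with u ⟨hsu, hLsu⟩ ⟨_, hr, hu, h⟩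
  exact ⟨hsu, hLsu ▸ hu, hr, h.symm.trans (congrArg φ (Subtype.ext hLsu))⟩

end IsLiftAt

section Lift

variable {X : Type u} [DiffeologicalSpace X] {k m : ℕ} {U : Opens ℝ^m}
  {W : Opens ℝ^k} {φ : U → X} {P : W → X}

theorem dSmooth_comp_of_contDiffAt (hφ : DSmooth φ) {S : Set W} {K : ℝ^k → ℝ^m}
    (hK : ∀ r : S, ContDiffAt ℝ ∞ K r) (hU : ∀ r : S, K r ∈ U) :
    DSmooth fun r : S => φ ⟨K r, hU r⟩ := by
  refine hφ.comp (g := φ) (f := fun r : S => (⟨K r, hU r⟩ : U)) fun j p hp => ?_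
  have hp' : ContDiff ℝ ∞ fun t => ((p t : W) : ℝ^k) := IsPlot.contDiff hp
  have hKp : ContDiff ℝ ∞ fun t => K (p t) :=
    contDiff_iff_contDiffAt.2 fun t => (hK (p t)).comp t hp'.contDiffAt
  exact hKp.isPlot

theorem IsLiftAt.exists_section (hφ : DSmooth φ) {Y : Type*} {f : X → Y} {P : W → Y}
    {L : ℝ^k → ℝ^m} {r₀ : W} (hL : IsLiftAt (f ∘ φ) P L r₀) :
    ∃ S : Set W, IsDOpen S ∧ r₀ ∈ S ∧ ∃ σ : S → Pullback f P, DSmooth σ ∧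
      ∀ r : S, ∃ hu : L r ∈ U, (σ r).1 = (↑r, φ ⟨L r, hu⟩) := by
  obtain ⟨B, hB, hBo, hr₀⟩ := eventually_nhds_iff.1 hL
  choose hLs _ hLU hφL using hB
  refine ⟨Subtype.val ⁻¹' B, isDOpen_iff_isOpen.2 (hBo.preimage continuous_subtype_val), hr₀,
    fun r => ⟨(r, φ ⟨L r, hLU r r.2⟩), (hφL r r.2).symm⟩, fun j p hp => ⟨hp, ?_⟩,
    fun r => ⟨hLU r r.2, rfl⟩⟩
  exact dSmooth_comp_of_contDiffAt hφ (fun r => hLs r r.2) (fun r => hLU r r.2) j p hp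

theorem IsDiffeologicalSubmersion.exists_isLiftAt (hφ : IsDiffeologicalSubmersion φ)
    (hP : DSmooth P) {r₀ : W} {u₀ : U} (h : φ u₀ = P r₀) :
    ∃ L : ℝ^k → ℝ^m, L r₀ = u₀ ∧ IsLiftAt φ P L r₀ := by
  obtain ⟨O, hO, σ, hσ, hσ₁, y₀, hy₀⟩ := (hφ.2 k W P hP).2 ⟨(r₀, u₀), h.symm⟩
  obtain ⟨L, hL⟩ := exists_contDiffAt_of_dSmooth hO (g := fun y => ((σ y).1.2 : ℝ^m))
    fun j p hp => (hσ j p hp).2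
  have hr₀ : (y₀ : W) = r₀ := (hσ₁ y₀).symm.trans (congrArg (fun p => p.1.1) hy₀)
  refine ⟨L, by rw [← hr₀, (hL y₀).1, hy₀], ?_⟩
  filter_upwards [hO.image_val_mem_nhds (hr₀ ▸ y₀.2)]
  rintro _ ⟨r, hr, rfl⟩
  obtain ⟨hLr, hLs⟩ := hL ⟨r, hr⟩
  refine ⟨hLs, r.2, hLr ▸ (σ ⟨r, hr⟩).1.2.2, ?_⟩
  calc φ ⟨L r, _⟩ = φ (σ ⟨r, hr⟩).1.2 := congrArg φ (Subtype.ext hLr)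
    _ = P (σ ⟨r, hr⟩).1.1 := (σ ⟨r, hr⟩).2.symm
    _ = P r := congrArg P (hσ₁ ⟨r, hr⟩)

theorem IsLiftAt.eventually_mem {X : Type*} {φ : U → X} {P : W → X} {L : ℝ^k → ℝ^m}
    {p₀ : Pullback φ P} (hL : IsLiftAt φ P L p₀.1.1) (hp₀ : L p₀.1.1 = p₀.1.2)
    {O : Set (Pullback φ P)} (hO : IsDOpen O) (hp₀O : p₀ ∈ O) :
    ∀ᶠ r in 𝓝 (p₀.1.1 : ℝ^k), ∃ p ∈ O, (p.1.1 : ℝ^k) = r ∧ (p.1.2 : ℝ^m) = L r := by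
  obtain ⟨S, hS, hr₀, σ, hσ, hσL⟩ := hL.exists_section (φ := id) dSmooth_id
  have hσ₀ : σ ⟨p₀.1.1, hr₀⟩ = p₀ := by
    obtain ⟨_, h⟩ := hσL ⟨p₀.1.1, hr₀⟩
    exact Subtype.ext (h.trans (Prod.ext rfl (Subtype.ext hp₀)))
  have hσO : IsDOpen (Subtype.val '' (σ ⁻¹' O) : Set W) := hS.image_val (hO.preimage hσ)
  filter_upwards [hσO.image_val_mem_nhds ⟨⟨p₀.1.1, hr₀⟩, by rwa [Set.mem_preimage, hσ₀], rfl⟩]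
  rintro _ ⟨_, ⟨r, hr, rfl⟩, rfl⟩
  obtain ⟨_, h⟩ := hσL r
  exact ⟨σ r, hr, by rw [h], by rw [h, id]⟩

theorem IsDiffeologicalEtale.eventuallyEq_of_isLiftAt (hφ : IsDiffeologicalEtale φ)
    (hP : DSmooth P) {L L' : ℝ^k → ℝ^m} {r₀ : ℝ^k} (hL : IsLiftAt φ P L r₀)
    (hL' : IsLiftAt φ P L' r₀) (h : L r₀ = L' r₀) : L =ᶠ[𝓝 r₀] L' := by
  obtain ⟨-, hr₀, hu₀, hφL⟩ := hL.self_of_nhds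
  let p₀ : Pullback φ P := ⟨(⟨r₀, hr₀⟩, ⟨L r₀, hu₀⟩), hφL.symm⟩
  obtain ⟨O, hO, hp₀, hinj⟩ := (hφ.2 k W P hP).exists_isDOpen_injOn p₀
  filter_upwards [hL.eventually_mem (p₀ := p₀) rfl hO hp₀,
    hL'.eventually_mem (p₀ := p₀) h.symm hO hp₀]
    with r ⟨p, hp, hpr, hpL⟩ ⟨q, hq, hqr, hqL⟩
  have hpq : p = q := hinj hp hq (Subtype.ext (hpr.trans hqr.symm))
  rw [← hpL, ← hqL, hpq]

end Lift

section InverseFunction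

variable {𝕜 : Type*} [RCLike 𝕜] {E F : Type*} [NormedAddCommGroup E] [NormedSpace 𝕜 E]
  [NormedAddCommGroup F] [NormedSpace 𝕜 F] {n : WithTop ℕ∞} {f : E → F} {a : E}

theorem exists_local_inverse [CompleteSpace E] (hn : n ≠ 0)
    (hf : ∀ᶠ x in 𝓝 a, ContDiffAt 𝕜 n f x) {f' : E ≃L[𝕜] F}
    (hf' : HasFDerivAt f (f' : E →L[𝕜] F) a) :
    ∃ s : F → E, s (f a) = a ∧ (∀ᶠ y in 𝓝 (f a), ContDiffAt 𝕜 n s y ∧ f (s y) = y) ∧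
      ∀ᶠ x in 𝓝 a, s (f x) = x := by
  have hfa : ContDiffAt 𝕜 n f a := hf.self_of_nhds
  let Φ : OpenPartialHomeomorph E F := hfa.toOpenPartialHomeomorph f hf' hn
  have ha : a ∈ Φ.source := hfa.mem_toOpenPartialHomeomorph_source hf' hn
  have hfaΦ : f a ∈ Φ.target := Φ.map_source ha
  have hΦa : Φ.symm (f a) = a := Φ.left_inv ha
  have hcont : ContinuousAt (fderiv 𝕜 f) a :=
    (hfa.fderiv_right (m := 0)
      (by simpa only [zero_add] using ENat.one_le_iff_ne_zero_withTop.2 hn)).continuousAt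
  have hequiv : ∀ᶠ x in 𝓝 a, fderiv 𝕜 f x ∈ Set.range ((↑) : (E ≃L[𝕜] F) → E →L[𝕜] F) :=
    hcont.eventually_mem (by rw [hf'.fderiv]; exact f'.nhds)
  have hsymm : Filter.Tendsto Φ.symm (𝓝 (f a)) (𝓝 a) := by
    simpa only [hΦa] using (Φ.symm.continuousAt hfaΦ).tendsto
  refine ⟨Φ.symm, hΦa, ?_, ?_⟩
  · filter_upwards [hsymm.eventually (hequiv.and hf), Φ.open_target.mem_nhds hfaΦ]
      with y ⟨⟨A, hA⟩, hfy⟩ hy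
    have hAy : HasFDerivAt Φ (A : E →L[𝕜] F) (Φ.symm y) :=
      hA ▸ (hfy.differentiableAt hn).hasFDerivAt
    exact ⟨Φ.contDiffAt_symm hy hAy hfy, Φ.right_inv hy⟩
  · filter_upwards [Φ.open_source.mem_nhds ha] with x hx
    exact Φ.left_inv hx

theorem exists_local_rightInverse [CompleteSpace F] (hn : n ≠ 0)
    (hf : ∀ᶠ x in 𝓝 a, ContDiffAt 𝕜 n f x) (hf' : (fderiv 𝕜 f a).HasRightInverse) :
    ∃ s : F → E, s (f a) = a ∧ ∀ᶠ y in 𝓝 (f a), ContDiffAt 𝕜 n s y ∧ f (s y) = y := by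
  -- Restricted to the affine complement `a + range A` of the kernel of its derivative, `f` is a
  -- local diffeomorphism.
  obtain ⟨A, hA⟩ := hf'
  let j : F → E := fun y => a + A y
  have hj : ContDiff 𝕜 n j := contDiff_const.add A.contDiff
  have hj₀ : j 0 = a := by simp only [j, map_zero, add_zero]
  have hfj : ∀ᶠ y in 𝓝 0, ContDiffAt 𝕜 n (f ∘ j) y := by
    have hja : Filter.Tendsto j (𝓝 0) (𝓝 a) := hj₀ ▸ hj.continuous.tendsto 0
    filter_upwards [hja.eventually hf] with y hy
    exact hy.comp y hj.contDiffAt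
  have hfj' : HasFDerivAt (f ∘ j) (ContinuousLinearEquiv.refl 𝕜 F : F →L[𝕜] F) 0 := by
    have hfa : HasFDerivAt f (fderiv 𝕜 f a) (j 0) := by
      rw [hj₀]
      exact (hf.self_of_nhds.differentiableAt hn).hasFDerivAt
    convert hfa.comp 0 (A.hasFDerivAt.const_add a)
    ext y
    exact (hA y).symm
  obtain ⟨s, hs₀, hs, -⟩ := exists_local_inverse hn hfj hfj'
  rw [Function.comp_apply, hj₀] at hs₀ hs
  refine ⟨j ∘ s, by rw [Function.comp_apply, hs₀, hj₀], ?_⟩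
  filter_upwards [hs] with y ⟨hsy, hfy⟩
  exact ⟨hj.contDiffAt.comp y hsy, hfy⟩

theorem exists_local_leftInverse [CompleteSpace E] (hn : n ≠ 0)
    (hf : ∀ᶠ x in 𝓝 a, ContDiffAt 𝕜 n f x) (hf' : (fderiv 𝕜 f a).HasLeftInverse) :
    ∃ s : F → E, s (f a) = a ∧ (∀ᶠ y in 𝓝 (f a), ContDiffAt 𝕜 n s y) ∧
      ∀ᶠ x in 𝓝 a, s (f x) = x := by
  obtain ⟨B, hB⟩ := hf'
  have hBf : ∀ᶠ x in 𝓝 a, ContDiffAt 𝕜 n (B ∘ f) x := by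
    filter_upwards [hf] with x hx
    exact B.contDiff.contDiffAt.comp x hx
  have hBf' : HasFDerivAt (B ∘ f) (ContinuousLinearEquiv.refl 𝕜 E : E →L[𝕜] E) a := by
    convert B.hasFDerivAt.comp a (hf.self_of_nhds.differentiableAt hn).hasFDerivAt
    ext x
    exact (hB x).symm
  obtain ⟨s, hs₀, hs, hsf⟩ := exists_local_inverse hn hBf hBf'
  refine ⟨s ∘ B, hs₀, ?_, hsf⟩
  filter_upwards [B.continuous.continuousAt.eventually hs] with y ⟨hsy, _⟩
  exact hsy.comp y B.contDiff.contDiffAt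

end InverseFunction

section TangentSpace

variable {X : Type u} [DiffeologicalSpace X] {x : X}

theorem isPlotMorphism_iff {Q P : CenteredPlot X x} {F : ℝ^Q.dim → ℝ^P.dim} :
    IsPlotMorphism Q P F ↔ F 0 = 0 ∧ IsLiftAt P.toFun Q.toFun F 0 := by
  refine and_congr_right fun _ => ⟨?_, fun hF => ?_⟩
  · rintro ⟨W, h0, hFW, hW⟩
    filter_upwards [W.isOpen.mem_nhds h0] with r hr
    obtain ⟨hQ, hP, h⟩ := hW r hr
    exact ⟨hFW.contDiffAt (W.isOpen.mem_nhds hr), hQ, hP, h.symm⟩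
  · obtain ⟨W, hW, hWo, h0⟩ := eventually_nhds_iff.1 hF
    refine ⟨⟨W, hWo⟩, h0, fun r hr => (hW r hr).1.contDiffWithinAt, fun r hr => ?_⟩
    obtain ⟨-, hQ, hP, h⟩ := hW r hr
    exact ⟨hQ, hP, h.symm⟩

namespace InternalTangentSpace

variable {V : Type*} [AddCommGroup V] [Module ℝ V]

open Classical in
/-- The linear map out of the colimit `T_x X` induced by a cocone `T` on the diagram of the spaces
`T₀(dom P)`. -/
noncomputable def lift (T : ∀ P : CenteredPlot X x, ℝ^P.dim →ₗ[ℝ] V)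
    (hT : ∀ (Q P : CenteredPlot X x) (F : ℝ^Q.dim → ℝ^P.dim), IsPlotMorphism Q P F →
      ∀ v, T P (fderiv ℝ F 0 v) = T Q v) :
    InternalTangentSpace X x →ₗ[ℝ] V :=
  (plotRel X x).liftQ (DirectSum.toModule ℝ (CenteredPlot X x) V T) <| Submodule.span_le.2 <| by
    rintro _ ⟨Q, P, F, v, hF, rfl⟩
    have hlof (P : CenteredPlot X x) (v : ℝ^P.dim) :
        DirectSum.toModule ℝ (CenteredPlot X x) V T (plotIncl P v) = T P v :=
      DirectSum.toModule_lof (M := fun P : CenteredPlot X x => ℝ^P.dim) ℝ P v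
    rw [SetLike.mem_coe, LinearMap.mem_ker, map_sub, hlof, hlof, hT Q P F hF, sub_self]

theorem lift_dPlot {T : ∀ P : CenteredPlot X x, ℝ^P.dim →ₗ[ℝ] V}
    (hT : ∀ (Q P : CenteredPlot X x) (F : ℝ^Q.dim → ℝ^P.dim), IsPlotMorphism Q P F →
      ∀ v, T P (fderiv ℝ F 0 v) = T Q v) (P : CenteredPlot X x) (v : ℝ^P.dim) :
    lift T hT (dPlot P v) = T P v := by
  classical
  exact DirectSum.toModule_lof (M := fun P : CenteredPlot X x => ℝ^P.dim) ℝ P v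

theorem hom_ext {S T : InternalTangentSpace X x →ₗ[ℝ] V}
    (h : ∀ (P : CenteredPlot X x) (v : ℝ^P.dim), S (dPlot P v) = T (dPlot P v)) : S = T := by
  classical
  exact Submodule.linearMap_qext _ (DirectSum.linearMap_ext ℝ fun P => LinearMap.ext (h P))

end InternalTangentSpace

variable {m : ℕ} {U : Opens ℝ^m} {φ : U → X} {u₀ : U}

theorem CenteredPlot.exists_isLiftAt (hφ : IsDiffeologicalEtale φ) (hu₀ : φ u₀ = x)
    (P : CenteredPlot X x) : ∃ L : ℝ^P.dim → ℝ^m, L 0 = u₀ ∧ IsLiftAt φ P.toFun L 0 :=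
  hφ.isDiffeologicalSubmersion.exists_isLiftAt P.smooth (r₀ := ⟨0, P.zero_mem⟩)
    (hu₀.trans P.map_zero.symm)

theorem IsPlotMorphism.fderiv_isLiftAt (hφ : IsDiffeologicalEtale φ) {Q P : CenteredPlot X x}
    {F : ℝ^Q.dim → ℝ^P.dim} (hF : IsPlotMorphism Q P F) {L : ℝ^Q.dim → ℝ^m} {M : ℝ^P.dim → ℝ^m}
    (hL : IsLiftAt φ Q.toFun L 0) (hM : IsLiftAt φ P.toFun M 0) (h : M 0 = L 0) (v : ℝ^Q.dim) :
    fderiv ℝ M 0 (fderiv ℝ F 0 v) = fderiv ℝ L 0 v := by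
  obtain ⟨hF₀, hF⟩ := isPlotMorphism_iff.1 hF
  rw [← hF₀] at hM h
  rw [← (hφ.eventuallyEq_of_isLiftAt Q.smooth (hM.comp hF) hL h).fderiv_eq,
    fderiv_comp 0 hM.differentiableAt hF.differentiableAt, hF₀]
  rfl

/-- The coordinates `T_x X → ℝᵐ` of internal tangent vectors with respect to an étale chart `φ` with
`φ u₀ = x`: the tangent vector `dP₀ v` has the coordinates `dL₀ v`, for `L` the lift of `P` through
`φ` with `L 0 = u₀`. -/
noncomputable def tangentCoord (hφ : IsDiffeologicalEtale φ) (hu₀ : φ u₀ = x) :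
    InternalTangentSpace X x →ₗ[ℝ] ℝ^m :=
  InternalTangentSpace.lift (fun P => (fderiv ℝ (P.exists_isLiftAt hφ hu₀).choose 0).toLinearMap)
    fun Q P _ hF v =>
      have hLQ := (Q.exists_isLiftAt hφ hu₀).choose_spec
      have hLP := (P.exists_isLiftAt hφ hu₀).choose_spec
      hF.fderiv_isLiftAt hφ hLQ.2 hLP.2 (hLP.1.trans hLQ.1.symm) v

theorem tangentCoord_dPlot (hφ : IsDiffeologicalEtale φ) (hu₀ : φ u₀ = x) {P : CenteredPlot X x}
    {L : ℝ^P.dim → ℝ^m} (hL₀ : L 0 = u₀) (hL : IsLiftAt φ P.toFun L 0) (v : ℝ^P.dim) :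
    tangentCoord hφ hu₀ (dPlot P v) = fderiv ℝ L 0 v := by
  obtain ⟨hL'₀, hL'⟩ := (P.exists_isLiftAt hφ hu₀).choose_spec
  rw [(hφ.eventuallyEq_of_isLiftAt P.smooth hL hL' (hL₀.trans hL'₀.symm)).fderiv_eq]
  exact InternalTangentSpace.lift_dPlot _ P v

/-- The chart `φ`, translated to a plot centered at `φ u₀`. -/
abbrev chartPlot (hφ : DSmooth φ) (u₀ : U) : CenteredPlot X (φ u₀) where
  dim := m
  dom := ⟨(fun v : ℝ^m => u₀ + v) ⁻¹' U, U.isOpen.preimage (continuous_const_add _)⟩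
  zero_mem := by
    change (u₀ + 0 : ℝ^m) ∈ U
    rw [add_zero]
    exact u₀.2
  toFun v := φ ⟨u₀ + v, v.2⟩
  smooth := by
    intro k p hp
    have hp' : ContDiff ℝ ∞ fun t => (p t : ℝ^m) := IsPlot.contDiff hp
    refine hφ k (fun t => ⟨u₀ + p t, (p t).2⟩) ?_
    exact (contDiff_const.add hp').isPlot
  map_zero := congrArg φ (Subtype.ext (add_zero _))

theorem isLiftAt_chartPlot_sub (hφ : DSmooth φ) (u₀ : U) :
    IsLiftAt (chartPlot hφ u₀).toFun φ (fun u : ℝ^m => u - u₀) u₀ := by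
  filter_upwards [U.isOpen.mem_nhds u₀.2] with u hu
  have hu' : (u₀ + (u - u₀) : ℝ^m) = u := add_sub_cancel _ _
  have hmem : (u₀ + (u - u₀) : ℝ^m) ∈ U := by rwa [hu']
  exact ⟨by fun_prop, hu, hmem, congrArg φ (Subtype.ext hu')⟩

theorem tangentCoord_bijective (hφ : IsDiffeologicalEtale φ) (hu₀ : φ u₀ = x) :
    Function.Bijective (tangentCoord hφ hu₀) := by
  subst hu₀
  have hadd : IsLiftAt φ (chartPlot hφ.1 u₀).toFun (fun v => u₀ + v) 0 := by
    filter_upwards [(chartPlot hφ.1 u₀).dom.isOpen.mem_nhds (chartPlot hφ.1 u₀).zero_mem] with v hv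
    exact ⟨by fun_prop, hv, hv, rfl⟩
  have hright (v : ℝ^m) : tangentCoord hφ (u₀ := u₀) rfl (dPlot (chartPlot hφ.1 u₀) v) = v := by
    rw [tangentCoord_dPlot hφ rfl (add_zero _) hadd, fderiv_const_add, fderiv_fun_id]
    rfl
  have hleft : dPlot (chartPlot hφ.1 u₀) ∘ₗ tangentCoord hφ (u₀ := u₀) rfl = LinearMap.id := by
    refine InternalTangentSpace.hom_ext fun P v => ?_
    obtain ⟨L, hL₀, hL⟩ := P.exists_isLiftAt hφ rfl
    have hsub : IsLiftAt (chartPlot hφ.1 u₀).toFun φ (fun u : ℝ^m => u - u₀) (L 0) := by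
      rw [hL₀]
      exact isLiftAt_chartPlot_sub hφ.1 u₀
    have hmor : IsPlotMorphism P (chartPlot hφ.1 u₀) fun r => (L r - u₀ : ℝ^m) :=
      isPlotMorphism_iff.2 ⟨sub_eq_zero.2 hL₀, hsub.comp hL⟩
    rw [LinearMap.comp_apply, tangentCoord_dPlot hφ rfl hL₀ hL, LinearMap.id_apply,
      ← dPlot_comp hmor, fderiv_sub_const]
  exact ⟨Function.LeftInverse.injective (g := dPlot (chartPlot hφ.1 u₀))
    (LinearMap.congr_fun hleft),
    Function.RightInverse.surjective hright⟩

variable {Y : Type v} [DiffeologicalSpace Y] {n : ℕ} {V : Opens ℝ^n} {ψ : V → Y} {f : X → Y}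
  {F : ℝ^m → ℝ^n}

theorem tangentCoord_comp_tangentMap (hφ : IsDiffeologicalEtale φ) (hψ : IsDiffeologicalEtale ψ)
    (hf : DSmooth f) (hu₀ : φ u₀ = x) {v₀ : V} (hv₀ : ψ v₀ = f x) (hFu₀ : F u₀ = v₀)
    (hF : IsLiftAt ψ (f ∘ φ) F u₀) :
    tangentCoord hψ hv₀ ∘ₗ tangentMap hf x =
      (fderiv ℝ F u₀).toLinearMap ∘ₗ tangentCoord hφ hu₀ := by
  refine InternalTangentSpace.hom_ext fun P v => ?_
  obtain ⟨L, hL₀, hL⟩ := P.exists_isLiftAt hφ hu₀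
  rw [← hL₀] at hF hFu₀
  have hFL : IsLiftAt ψ (P.map hf).toFun (F ∘ L) 0 := hF.comp (hL.map f)
  rw [LinearMap.comp_apply, LinearMap.comp_apply, tangentMap_dPlot,
    tangentCoord_dPlot hφ hu₀ hL₀ hL, ← hL₀]
  refine (tangentCoord_dPlot hψ hv₀ hFu₀ hFL v).trans ?_
  exact DFunLike.congr_fun (fderiv_comp 0 hF.differentiableAt hL.differentiableAt) v

theorem fderiv_surjective_of_tangentMap (hφ : IsDiffeologicalEtale φ)
    (hψ : IsDiffeologicalEtale ψ) (hf : DSmooth f) (hF : IsLiftAt ψ (f ∘ φ) F u₀)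
    (hsurj : Function.Surjective (tangentMap hf (φ u₀))) :
    Function.Surjective (fderiv ℝ F u₀) := by
  obtain ⟨_, _, _, hv₀⟩ := hF.self_of_nhds
  have h : tangentCoord hψ hv₀ ∘ tangentMap hf (φ u₀) =
      fderiv ℝ F u₀ ∘ tangentCoord hφ (u₀ := u₀) rfl :=
    congrArg DFunLike.coe (tangentCoord_comp_tangentMap hφ hψ hf rfl hv₀ rfl hF)
  refine Function.Surjective.of_comp (g := tangentCoord hφ (u₀ := u₀) rfl) ?_
  rw [← h]
  exact (tangentCoord_bijective hψ hv₀).2.comp hsurj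

theorem fderiv_injective_of_tangentMap (hφ : IsDiffeologicalEtale φ)
    (hψ : IsDiffeologicalEtale ψ) (hf : DSmooth f) (hF : IsLiftAt ψ (f ∘ φ) F u₀)
    (hinj : Function.Injective (tangentMap hf (φ u₀))) :
    Function.Injective (fderiv ℝ F u₀) := by
  obtain ⟨_, _, _, hv₀⟩ := hF.self_of_nhds
  have h : tangentCoord hψ hv₀ ∘ tangentMap hf (φ u₀) =
      fderiv ℝ F u₀ ∘ tangentCoord hφ (u₀ := u₀) rfl :=
    congrArg DFunLike.coe (tangentCoord_comp_tangentMap hφ hψ hf rfl hv₀ rfl hF)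
  refine Function.Injective.of_comp_right ?_ (tangentCoord_bijective hφ (u₀ := u₀) rfl).2
  rw [← h]
  exact (tangentCoord_bijective hψ hv₀).1.comp hinj

end TangentSpace

section EtaleManifold

variable {M : Type u} {N : Type v} [DiffeologicalSpace M] [DiffeologicalSpace N] {m n : ℕ}
  {f : M → N}

theorem IsEtaleManifold.exists_local_rep (hM : IsEtaleManifold m M) (hN : IsEtaleManifold n N)
    (hf : DSmooth f) {k : ℕ} {W : Opens ℝ^k} {P : W → N} (hP : DSmooth P) {r₀ : W} {x₀ : M}
    (h : P r₀ = f x₀) :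
    ∃ (U : Opens ℝ^m) (φ : U → M) (u₀ : U) (V : Opens ℝ^n) (ψ : V → N) (F : ℝ^m → ℝ^n)
      (L : ℝ^k → ℝ^n), IsDiffeologicalEtale φ ∧ φ u₀ = x₀ ∧ IsDiffeologicalEtale ψ ∧
        IsLiftAt ψ (f ∘ φ) F u₀ ∧ IsLiftAt ψ P L r₀ ∧ L r₀ = F u₀ := by
  obtain ⟨A, hA, hxA⟩ := hM
  obtain ⟨B, hB, hyB⟩ := hN
  obtain ⟨⟨U, φ⟩, hφA, u₀, rfl⟩ := hxA x₀
  obtain ⟨⟨V, ψ⟩, hψB, v₀, hv₀⟩ := hyB (f (φ u₀))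
  have hφ := hA _ hφA
  have hψ := hB _ hψB
  obtain ⟨F, hF₀, hF⟩ := hψ.isDiffeologicalSubmersion.exists_isLiftAt (hf.comp hφ.1) hv₀
  obtain ⟨L, hL₀, hL⟩ := hψ.isDiffeologicalSubmersion.exists_isLiftAt hP (hv₀.trans h.symm)
  exact ⟨U, φ, u₀, V, ψ, F, L, hφ, rfl, hψ, hF, hL, hL₀.trans hF₀.symm⟩

theorem isDiffeologicalSubmersion_of_tangentMap_surjective (hM : IsEtaleManifold m M)
    (hN : IsEtaleManifold n N) (hf : DSmooth f)
    (hd : ∀ x, Function.Surjective (tangentMap hf x)) : IsDiffeologicalSubmersion f := by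
  refine ⟨hf, fun k W P hP => ⟨fun _ _ hp => hp.1, ?_⟩⟩
  rintro ⟨⟨r₀, x₀⟩, hrx⟩
  obtain ⟨U, φ, u₀, V, ψ, F, L, hφ, rfl, hψ, hF, hL, hL₀⟩ := hM.exists_local_rep hN hf hP hrx
  obtain ⟨s, hs₀, hs⟩ := exists_local_rightInverse (by simp) hF.eventually_contDiffAt
    (.of_surjective_of_finiteDimensional <|
      fderiv_surjective_of_tangentMap hφ hψ hf hF (hd (φ u₀)))
  have hsψ : IsLiftAt (f ∘ φ) ψ s (L r₀) := hL₀ ▸ hF.of_rightInverse hs₀ hs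
  obtain ⟨S, hS, hr₀, σ, hσ, hσL⟩ := (hsψ.comp hL).exists_section hφ.1
  refine ⟨S, hS, σ, hσ, fun r => ?_, ⟨r₀, hr₀⟩, ?_⟩
  · obtain ⟨_, h⟩ := hσL r
    exact congrArg Prod.fst h
  · obtain ⟨_, h⟩ := hσL ⟨r₀, hr₀⟩
    have hsL₀ : s (L r₀) = u₀ := by rw [hL₀, hs₀]
    exact Subtype.ext (h.trans (Prod.ext rfl (congrArg φ (Subtype.ext hsL₀))))

/-- For local representatives `F` of `f` (in charts `φ` and `ψ`) and `L` of a plot `P` (in the chart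
`ψ`), the set of the points `(r, φ u)` of `P^*M` with `u ∈ A` and `r ∈ B` that satisfy not only
`P r = f (φ u)` but also `L r = F u`. The two differ, since `ψ` need not be injective. -/
def matchedSet {k : ℕ} {U : Opens ℝ^m} {W : Opens ℝ^k} (f : M → N) (φ : U → M) (P : W → N)
    (F : ℝ^m → ℝ^n) (L : ℝ^k → ℝ^n) (A : Set ℝ^m) (B : Set ℝ^k) : Set (Pullback f P) :=
  {p | ∃ u : U, ↑u ∈ A ∧ ↑p.1.1 ∈ B ∧ φ u = p.1.2 ∧ F u = L p.1.1}

variable {k : ℕ} {U : Opens ℝ^m} {V : Opens ℝ^n} {W : Opens ℝ^k} {φ : U → M} {ψ : V → N}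
  {P : W → N} {F : ℝ^m → ℝ^n} {L : ℝ^k → ℝ^n} {A : Set ℝ^m} {B : Set ℝ^k}

theorem isDOpen_matchedSet (hφ : IsDiffeologicalEtale φ) (hψ : IsDiffeologicalEtale ψ)
    (hf : DSmooth f) (hA : IsOpen A) (hB : IsOpen B) (hF : ∀ u ∈ A, IsLiftAt ψ (f ∘ φ) F u)
    (hL : ∀ r ∈ B, IsLiftAt ψ P L r) : IsDOpen (matchedSet f φ P F L A B) := by
  refine isDOpen_iff_eventually.2 fun j p hp t₀ ⟨u, huA, hrB, hux, hFL⟩ => ?_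
  have hr : ContDiff ℝ ∞ fun t => ((p t).1.1 : ℝ^k) := IsPlot.contDiff hp.1
  let x : (⊤ : Opens ℝ^j) → M := fun t => (p t).1.2
  have hx : DSmooth x := fun _ q hq => isPlot_reparam hp.2 (IsPlot.contDiff hq)
  obtain ⟨G, hG₀ : G t₀ = u, hG⟩ :=
    hφ.isDiffeologicalSubmersion.exists_isLiftAt hx (r₀ := ⟨t₀, trivial⟩) hux
  have hFG : IsLiftAt ψ (f ∘ x) (F ∘ G) t₀ := by
    refine IsLiftAt.comp ?_ (hG.map f)
    rw [hG₀]
    exact hF u huA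
  have hLr : IsLiftAt ψ (f ∘ x) (fun t => L (p t).1.1) t₀ := by
    filter_upwards [hr.continuous.continuousAt.eventually (hL _ hrB)] with t ⟨hLt, _, hv, h⟩
    exact ⟨hLt.comp t hr.contDiffAt, trivial, hv, h.trans (p t).2⟩
  have hFGL : F ∘ G =ᶠ[𝓝 t₀] fun t => L (p t).1.1 :=
    hψ.eventuallyEq_of_isLiftAt (hf.comp hx) hFG hLr (by rw [Function.comp_apply, hG₀, hFL])
  filter_upwards [hG, hFGL, hG.continuousAt.eventually_mem (hA.mem_nhds (hG₀ ▸ huA)),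
    hr.continuous.continuousAt.eventually_mem (hB.mem_nhds hrB)] with t ⟨_, _, hu, hφG⟩ hFt hGA htB
  exact ⟨⟨G t, hu⟩, hGA, htB, hφG, hFt⟩

theorem isDiffeologicalImmersion_of_tangentMap_injective (hM : IsEtaleManifold m M)
    (hN : IsEtaleManifold n N) (hf : DSmooth f)
    (hd : ∀ x, Function.Injective (tangentMap hf x)) : IsDiffeologicalImmersion f := by
  refine ⟨hf, fun k W P hP => ?_⟩
  rintro ⟨⟨r₀, x₀⟩, hrx⟩
  obtain ⟨U, φ, u₀, V, ψ, F, L, hφ, rfl, hψ, hF, hL, hL₀⟩ := hM.exists_local_rep hN hf hP hrx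
  obtain ⟨s, hs₀, hs, hsF⟩ := exists_local_leftInverse (by simp) hF.eventually_contDiffAt
    (.of_injective_of_finiteDimensional <|
      fderiv_injective_of_tangentMap hφ hψ hf hF (hd (φ u₀)))
  have hsU : ∀ᶠ v in 𝓝 (L r₀), ContDiffAt ℝ ∞ s v ∧ s v ∈ U := by
    rw [hL₀]
    exact hs.and <| hs.self_of_nhds.continuousAt.eventually_mem
      (hs₀.symm ▸ U.isOpen.mem_nhds u₀.2)
  obtain ⟨A, hA, hAo, hu₀⟩ := eventually_nhds_iff.1 (hF.eventually_isLiftAt.and hsF)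
  obtain ⟨B, hB, hBo, hr₀⟩ :=
    eventually_nhds_iff.1 (hL.eventually_isLiftAt.and (hL.continuousAt.eventually hsU))
  have hsL (r : (Subtype.val ⁻¹' B : Set W)) : ContDiffAt ℝ ∞ (s ∘ L) r :=
    (hB r r.2).2.1.comp _ (hB r r.2).1.contDiffAt
  refine ⟨matchedSet f φ P F L A B,
    isDOpen_matchedSet hφ hψ hf hAo hBo (fun u hu => (hA u hu).1) fun r hr => (hB r hr).1,
    ⟨u₀, hu₀, hr₀, rfl, hL₀.symm⟩, Subtype.val ⁻¹' B, fun p ⟨_, _, hp, _⟩ => hp,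
    hBo.preimage continuous_subtype_val, fun r => (r, φ ⟨s (L r), (hB r r.2).2.2⟩),
    fun j q hq => ⟨hq, dSmooth_comp_of_contDiffAt hφ.1 hsL (fun r => (hB r r.2).2.2) j q hq⟩, ?_⟩
  rintro p ⟨u, huA, hp, hux, hFL⟩
  have hsLu : s (L p.1.1) = u := by rw [← hFL, (hA u huA).2]
  exact Prod.ext rfl ((congrArg φ (Subtype.ext hsLu)).trans hux)

theorem isDiffeologicalEtale_of_tangentMap_bijective (hM : IsEtaleManifold m M)
    (hN : IsEtaleManifold n N) (hf : DSmooth f)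
    (hd : ∀ x, Function.Bijective (tangentMap hf x)) : IsDiffeologicalEtale f :=
  have hsub := isDiffeologicalSubmersion_of_tangentMap_surjective hM hN hf fun x => (hd x).2
  hsub.isDiffeologicalEtale <|
    isDiffeologicalImmersion_of_tangentMap_injective hM hN hf fun x => (hd x).1

end EtaleManifold

end DiffeologicalEtale

theorem theorem6p10 {M : Type u} {N : Type v} [DiffeologicalSpace M] [DiffeologicalSpace N]
    (m n : ℕ) (hM : DiffeologicalEtale.IsEtaleManifold m M)
    (hN : DiffeologicalEtale.IsEtaleManifold n N)
    (f : M → N) (hf : Diffeology.DSmooth f) :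
    ((∀ x : M, Function.Surjective (DiffeologicalEtale.tangentMap hf x)) →
      DiffeologicalEtale.IsDiffeologicalSubmersion f) ∧
    ((∀ x : M, Function.Injective (DiffeologicalEtale.tangentMap hf x)) →
      DiffeologicalEtale.IsDiffeologicalImmersion f) ∧
    ((∀ x : M, Function.Bijective (DiffeologicalEtale.tangentMap hf x)) →
      DiffeologicalEtale.IsDiffeologicalEtale f) := by
  open DiffeologicalEtale in
  exact ⟨isDiffeologicalSubmersion_of_tangentMap_surjective hM hN hf,
    isDiffeologicalImmersion_of_tangentMap_injective hM hN hf,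
    isDiffeologicalEtale_of_tangentMap_bijective hM hN hf⟩
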